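/- **Setting.** All graphs are finite and simple, and all tensors are complex. Let $V$ be a finite set. A $V$-tensor is an element of $\bigotimes_{v\in V}U_v$ with finite-dimensional complex vector spaces $U_v$; tensor products, powers and direct sums of $V$-tensors are taken leg by leg, so they are again $V$-tensors (with legs $U_v\otimes W_v$, $U_v^{\otimes n}$, $\bigoplus_i U_{i,v}$). A tensor $\phi\in\bigotimes_v U_v$ *restricts* to $\psi\in\bigotimes_v W_v$, written $\phi\ge\psi$, if $\psi=(\bigotimes_v A_v)\phi$ for some linear maps $A_v:U_v\to W_v$, and *degenerates* to $\psi$ if $\psi$ lies in the Zariski closure of $\{(\bigotimes_v A_v)\phi \mid A_v:U_v\to W_v \text{ linear}\}$. Let $b_1,b_2,\dots$ denote standard basis vectors, and let $T_r=\sum_{j=1}^r\bigotimes_{v\in V}b_j\in(\mathbb C^r)^{\otimes V}$. The *border rank* $\underline{R}(\psi)$ is the least $r\in\mathbb N$ such that $T_r$ degenerates to $\psi$. The *exponent* of $\psi$ is $$\omega(\psi)=\lim_{n\to\infty}\tfrac1n\min\{m\in\mathbb N\mid T_2^{\otimes m}\ge\psi^{\otimes n}\}.$$ Let $G=(V,E)$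 be a graph. For $f:E\to\mathbb N$ define the nonuniform graph tensor $$T_f(G)=\sum_{i\in\prod_{e\in E}\{1,\dots,f(e)\}}\ \bigotimes_{v\in V}\Bigl(\bigotimes_{e\in E:\,v\in e}b_{i_e}\Bigr)\in\bigotimes_{v\in V}\Bigl(\bigotimes_{e\in E:\,v\in e}\mathbb C^{f(e)}\Bigr),$$ let $T(G)=T_f(G)$ for the constant function $f=2$, and let $\tau(T(G))=\omega(T(G))/|E|$ be the exponent per edge. The graph $G$ is *edge-transitive* if for any two edges $e_1,e_2$ (unordered pairs of vertices) there is an automorphism of $G$ that maps $e_1$ to $e_2$. **Theorem (generalized asymptotic sum inequality).** Let $G=(V,E)$ be an edge-transitive graph, let $p\ge1$, let $f_1,\dots,f_p:E\to\mathbb N$, and put $\phi_i=T_{f_i}(G)$. 1. Suppose that $\prod_{e\in E}f_i(e)\ge2$ for every $i$, and let $r>p$ be a real number with $\underline{R}(\phi_1\oplus\cdots\oplus\phi_p)\le r$. Then there is exactly one real number $\tau$ with $$\sum_{i=1}^p\Bigl(\prod_{e\in E}f_i(e)\Bigr)^{\tau}=r,$$ and $\tau(T(G))\le\tau$ for this $\tau$.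 2. In particular, if $q\ge2$ is an integer and $\prod_{e\in E}f_i(e)=q$ for every $i$, then $$\tau(T(G))\le\log_q\bigl(\underline{R}(\phi_1\oplus\cdots\oplus\phi_p)/p\bigr).$$ -/

import Mathlib

/-!
Tensors with legs labelled by a finite type `V` are written in coordinates: an element of
`⨂_{v ∈ V} ℂ^{ι v}` is its array of coefficients in the product of the standard bases, that is,
a function on `∀ v, ι v`.
-/

noncomputable section

namespace GraphTensor

/-- The space `⨂_{v ∈ V} ℂ^{ι v}`, in coordinates with respect to the standard product basis. -/
abbrev Tensor {V : Type*} (ι : V → Type*) : Type _ := (∀ v, ι v) → ℂ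

/-- The simple tensor `⨂_v u_v`. -/
def simpleTensor {V : Type*} [Fintype V] {ι : V → Type*} (u : ∀ v, ι v → ℂ) : Tensor ι :=
  fun x => ∏ v, u v (x v)

/-- The image `(⨂_v A_v) φ` of a tensor under linear maps `A_v : ℂ^{ι v} → ℂ^{κ v}`, given by
their matrices. -/
def applyMaps {V : Type*} [Fintype V] [DecidableEq V] {ι κ : V → Type*} [∀ v, Fintype (ι v)]
    (A : ∀ v, Matrix (κ v) (ι v) ℂ) (φ : Tensor ι) : Tensor κ :=
  fun y => ∑ x : ∀ v, ι v, (∏ v, A v (y v) (x v)) * φ x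

/-- `φ ≥ ψ`: the tensor `φ` restricts to `ψ`. -/
def Restricts {V : Type*} [Fintype V] [DecidableEq V] {ι κ : V → Type*} [∀ v, Fintype (ι v)]
    (φ : Tensor ι) (ψ : Tensor κ) : Prop :=
  ∃ A : ∀ v, Matrix (κ v) (ι v) ℂ, ψ = applyMaps A φ

/-- The Zariski closure of a set of points of the affine space `ℂ^I`. -/
def zariskiClosure {I : Type*} (S : Set (I → ℂ)) : Set (I → ℂ) :=
  MvPolynomial.zeroLocus ℂ (MvPolynomial.vanishingIdeal ℂ S)

/-- `φ ⊵ ψ`: the tensor `φ` degenerates to `ψ`, that is, `ψ` is in the Zariski closure of the set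
of all images `(⨂_v A_v) φ` in the space of `ψ`. (When `φ` and `ψ` lie in the same space this is
the closure of the orbit of `φ` under the product of the general linear groups, since invertible
matrices are Zariski dense in all square matrices.) -/
def Degenerates {V : Type*} [Fintype V] [DecidableEq V] {ι κ : V → Type*} [∀ v, Fintype (ι v)]
    (φ : Tensor ι) (ψ : Tensor κ) : Prop :=
  ψ ∈ zariskiClosure {χ : Tensor κ | Restricts φ χ}

/-- The unit (GHZ) tensor `T_r = ∑_{j ∈ [r]} b_j ⊗ ⋯ ⊗ b_j` with legs labelled by `V`. -/
def unitTensor (V : Type*) [Fintype V] (r : ℕ) : Tensor (fun _ : V => Fin r) :=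
  ∑ j : Fin r, simpleTensor fun _ => Pi.single j 1

/-- The border rank: the smallest `r` such that `T_r` degenerates to `ψ`. -/
def borderRank {V : Type*} [Fintype V] [DecidableEq V] {κ : V → Type*} (ψ : Tensor κ) : ℕ :=
  sInf {r : ℕ | Degenerates (unitTensor V r) ψ}

/-- The tensor power `φ^{⊗ n}`, grouped as a tensor with the same set `V` of legs; the leg at `v`
is `(ℂ^{ι v})^{⊗ n}`, with standard basis indexed by `Fin n → ι v`. -/
def tensorPow {V : Type*} {ι : V → Type*} (φ : Tensor ι) (n : ℕ) :
    Tensor (fun v => Fin n → ι v) :=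
  fun x => ∏ j, φ (fun v => x v j)

/-- The direct sum `φ_1 ⊕ ⋯ ⊕ φ_p`, in `⨂_v (⨁_i ℂ^{ι i v})`: the `i`-th summand is extended by
zero from the `i`-th diagonal block. -/
def directSum {V : Type*} {p : ℕ} {ι : Fin p → V → Type*} (φ : ∀ i, Tensor (ι i)) :
    Tensor (fun v => Σ i, ι i v) :=
  fun x => ∑ i, Function.extend (fun (y : ∀ v, ι i v) v => (⟨i, y v⟩ : Σ i, ι i v)) (φ i) 0 x

/-- The least number `m` of copies such that `φ^{⊗ m} ≥ ψ^{⊗ n}`, which is `∞` if there is none. -/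
def copiesNeeded {V : Type*} [Fintype V] [DecidableEq V] {ι κ : V → Type*} [∀ v, Fintype (ι v)]
    (φ : Tensor ι) (ψ : Tensor κ) (n : ℕ) : EReal :=
  ⨅ (m : ℕ) (_ : Restricts (tensorPow φ m) (tensorPow ψ n)), (m : EReal)

/-- The asymptotic conversion rate `ω(φ, ψ) = lim_n (1/n) min {m | φ^{⊗ m} ≥ ψ^{⊗ n}}`, written
as an upper limit so that it is defined for all tensors. -/
def conversionRate {V : Type*} [Fintype V] [DecidableEq V] {ι κ : V → Type*}
    [∀ v, Fintype (ι v)] (φ : Tensor ι) (ψ : Tensor κ) : EReal :=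
  Filter.limsup (fun n : ℕ => copiesNeeded φ ψ n / (n : EReal)) Filter.atTop

/-- The exponent `ω(ψ) = ω(T_2, ψ)`. -/
def exponent {V : Type*} [Fintype V] [DecidableEq V] {κ : V → Type*} (ψ : Tensor κ) : EReal :=
  conversionRate (unitTensor V 2) ψ

section Graph

variable {V : Type*} [Fintype V] [DecidableEq V] (G : SimpleGraph V) [DecidableRel G.Adj]

/-- The standard basis of the leg at `v` of `T_f(G)`, namely of the tensor product of the spaces
`ℂ^{f e}` over the edges `e` at `v`. -/
abbrev LegIndex (f : G.edgeSet → ℕ) (v : V) : Type _ :=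
  ∀ e : {e : G.edgeSet // v ∈ e.1}, Fin (f e.1)

/-- The nonuniform graph tensor
`T_f(G) = ∑_i ⨂_{v ∈ V} (⨂_{e ∋ v} b_{i_e})`, with `i` ranging over `∏_{e ∈ E} [f e]`. -/
def graphTensor (f : G.edgeSet → ℕ) : Tensor (LegIndex G f) :=
  ∑ i : ∀ e : G.edgeSet, Fin (f e), simpleTensor fun _ => Pi.single (fun e => i e.1) 1

/-- The exponent per edge `τ(T(G)) = ω(T(G)) / |E|`, where `T(G) = T_2(G)`. -/
def exponentPerEdge : EReal :=
  exponent (graphTensor G fun _ => 2) / (Fintype.card G.edgeSet : EReal)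

end Graph

/-- The automorphism group acts transitively on the (undirected) edges. -/
def IsEdgeTransitive {V : Type*} (G : SimpleGraph V) : Prop :=
  ∀ e₁ ∈ G.edgeSet, ∀ e₂ ∈ G.edgeSet, ∃ σ : G ≃g G, Sym2.map σ e₁ = e₂

end GraphTensor

end

/-!
The proof follows Schönhage's asymptotic sum inequality, with permutations of the three matrix
dimensions replaced by automorphisms of the graph. Write `ψ = ⨁_i T_{f i}(G)`, `R` for its border
rank, and `a_i = ∏_e f i e`.

*From border rank to rank.* The coefficients of `χ^{⊗ N}` are monomials in those of `χ`, and a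
linear functional that vanishes on `χ^{⊗ N}` for all restrictions `χ` of `T_R` is a polynomial
vanishing on these restrictions, hence at `ψ`. So `ψ^{⊗ N}` is a linear combination of such powers,
and polynomially many of them suffice because there are only polynomially many monomials. Hence
`ψ^{⊗ N}` has rank at most `(N + 1) ^ D * R ^ N` (`Degenerates.rankLE_tensorPow`). No curves in
algebraic varieties are needed.

*From the direct sum to copies of one tensor.* The power `ψ^{⊗ N}` is a direct sum over words of
length `N` in the summands, and words with the same letter counts give the same nonuniform graph
tensor `T_F(G)`. Since `(∑ a_i ^ τ) ^ N` is a sum over words and there are at most `(N + 1) ^ p`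
letter counts, some `C` words give `C` copies of one `T_F(G)` with
`C * (∏_e F e) ^ τ ≥ (∑ a_i ^ τ) ^ N / (N + 1) ^ p` (`exists_words`, `RankLE.copies_of_words`).

*Making the bonds uniform.* The product of these copies over all automorphisms of `G` is a number of
copies of a graph tensor whose bond size is the same at every edge, by edge-transitivity
(`RankLE.copies_prod_iso`, `IsEdgeTransitive.exists_prod_eq`).

*From many copies to one.* If `C` copies of `T_f(G)` have rank at most `Q * C`, then `T_f(G)^{⊗ s}`
has rank at most `Q ^ s * C`: expanding one factor of `C` copies of `T_f(G)^{⊗ (s + 1)}` leaves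
`Q` groups of `C` copies of `T_f(G)^{⊗ s}` (`RankLE.copies_mul_of_le`, `RankLE.copies_pow`). For
large `s` the factor `C` disappears, so that `ω(T_f(G)) ≤ log_2 Q`. Combining the estimates and
letting `N → ∞` gives `τ(T(G)) ≤ τ` (`exponentPerEdge_le`).

The case of equal `a_i = q` is the solution `τ = log_q (R / p)`, which is nonnegative because
flattenings show `R ≥ p` (`le_borderRank_directSum`).
-/

namespace GraphTensor

/-! ### Indicators of propositions -/

open Classical in
/-- The complex number `1` if `P` holds and `0` otherwise, with classical decidability. All graph
tensors and unit tensors are arrays of such numbers. -/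
noncomputable def boole (P : Prop) : ℂ := if P then 1 else 0

theorem boole_true {P : Prop} (h : P) : boole P = 1 := if_pos h

theorem boole_false {P : Prop} (h : ¬P) : boole P = 0 := if_neg h

theorem boole_congr {P Q : Prop} (h : P ↔ Q) : boole P = boole Q := by rw [propext h]

theorem boole_and (P Q : Prop) : boole (P ∧ Q) = boole P * boole Q := by
  by_cases hP : P <;> by_cases hQ : Q <;> simp [boole, hP, hQ]

theorem prod_boole {J : Type*} [Fintype J] (P : J → Prop) :
    ∏ j, boole (P j) = boole (∀ j, P j) := by
  classical
  simp [boole, Fintype.prod_boole]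

/-! ### Rank of tensors in coordinates -/

section Rank

variable {V : Type*} [Fintype V] {κ κ' : V → Type*}

/-- The tensor `ψ` is a sum of `L` simple tensors `⨂_v u_{j,v}`, that is, has rank at most `L`. -/
def RankLE (ψ : Tensor κ) (L : ℕ) : Prop :=
  ∃ u : Fin L → ∀ v, κ v → ℂ, ∀ x, ψ x = ∑ j, ∏ v, u j v (x v)

/-- A sum of simple tensors over any type with at most `L` elements witnesses rank at most `L`;
the missing terms are padded with zero vectors, which requires at least one leg. -/
theorem RankLE.of_fintype [Nonempty V] {J : Type*} [Fintype J] {ψ : Tensor κ} {L : ℕ}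
    (u : J → ∀ v, κ v → ℂ) (hL : Fintype.card J ≤ L) (h : ∀ x, ψ x = ∑ j, ∏ v, u j v (x v)) :
    RankLE ψ L := by
  obtain ⟨e⟩ : Nonempty (J ↪ Fin L) := Function.Embedding.nonempty_of_card_le (by simpa using hL)
  refine ⟨Function.extend e u 0, fun x => (h x).trans ?_⟩
  refine Fintype.sum_of_injective e e.injective _ _ (fun i hi => ?_) fun i => ?_
  · obtain ⟨v⟩ := ‹Nonempty V›
    rw [Function.extend_apply' _ _ _ (by simpa using hi)]
    exact Finset.prod_eq_zero (Finset.mem_univ v) rfl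
  · rw [e.injective.extend_apply]

theorem RankLE.mono [Nonempty V] {ψ : Tensor κ} {L L' : ℕ} (h : RankLE ψ L) (hL : L ≤ L') :
    RankLE ψ L' := by
  obtain ⟨u, hu⟩ := h
  exact RankLE.of_fintype u (by simpa using hL) hu

/-- Relabelling, repeating and deleting basis vectors leg by leg does not increase the rank. -/
theorem RankLE.comp {ψ : Tensor κ} {L : ℕ} (h : RankLE ψ L) (β : ∀ v, κ' v → κ v) :
    RankLE (fun x => ψ fun v => β v (x v) : Tensor κ') L := by
  obtain ⟨u, hu⟩ := h
  exact ⟨fun j v k => u j v (β v k), fun x => hu _⟩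

theorem RankLE.mul [Nonempty V] {ψ : Tensor κ} {ψ' : Tensor κ'} {L L' : ℕ} (h : RankLE ψ L)
    (h' : RankLE ψ' L') :
    RankLE (fun x => ψ (fun v => (x v).1) * ψ' fun v => (x v).2 : Tensor fun v => κ v × κ' v)
      (L * L') := by
  obtain ⟨u, hu⟩ := h
  obtain ⟨u', hu'⟩ := h'
  refine RankLE.of_fintype (J := Fin L × Fin L') (fun j v k => u j.1 v k.1 * u' j.2 v k.2)
    (by simp) fun x => ?_
  simp only [hu, hu', Finset.sum_mul_sum, Fintype.sum_prod_type, Finset.prod_mul_distrib]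

theorem RankLE.pow [Nonempty V] {ψ : Tensor κ} {L : ℕ} (h : RankLE ψ L) (N : ℕ) :
    RankLE (tensorPow ψ N) (L ^ N) := by
  obtain ⟨u, hu⟩ := h
  refine RankLE.of_fintype (J := Fin N → Fin L) (fun j v k => ∏ n, u (j n) v (k n))
    (by simp) fun x => ?_
  simp only [tensorPow, hu, Fintype.prod_sum]
  exact Finset.sum_congr rfl fun j _ => Finset.prod_comm

theorem RankLE.sum_smul [Nonempty V] {J : Type*} [Fintype J] {ψ : J → Tensor κ} {L : ℕ}
    (h : ∀ j, RankLE (ψ j) L) (a : J → ℂ) {M : ℕ} (hM : Fintype.card J ≤ M) :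
    RankLE (∑ j, a j • ψ j) (M * L) := by
  classical
  choose u hu using h
  obtain ⟨v₀⟩ := id ‹Nonempty V›
  refine RankLE.of_fintype (J := J × Fin L)
    (fun j v k => (if v = v₀ then a j.1 else 1) * u j.1 j.2 v k)
    (by simpa using Nat.mul_le_mul_right L hM) fun x => ?_
  simp only [Finset.sum_apply, Pi.smul_apply, smul_eq_mul, hu, Fintype.sum_prod_type,
    Finset.prod_mul_distrib, Finset.mul_sum, Fintype.prod_ite_eq']

theorem exists_rankLE [Nonempty V] [DecidableEq V] [∀ v, Fintype (κ v)] (ψ : Tensor κ) :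
    ∃ L, RankLE ψ L := by
  classical
  have key : ψ = ∑ y : ∀ v, κ v, ψ y • simpleTensor fun v => Pi.single (y v) 1 := by
    ext x
    have hx : ∀ y : ∀ v, κ v, (∀ v, x v = y v) ↔ y = x := fun y => by
      rw [funext_iff]; exact forall_congr' fun v => eq_comm
    simp [Finset.sum_apply, simpleTensor, Pi.single_apply, Fintype.prod_boole, hx]
  rw [key]
  exact ⟨_, RankLE.sum_smul (L := 1)
    (fun y => ⟨fun _ v => Pi.single (y v) 1, fun x => by simp [simpleTensor]⟩) _ le_rfl⟩

end Rank

/-! ### Unit tensors -/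

section Unit

variable {V : Type*} [Fintype V] [DecidableEq V]

omit [DecidableEq V] in
theorem unitTensor_apply [Nonempty V] {r : ℕ} (x : V → Fin r) :
    unitTensor V r x = boole (∀ u v, x u = x v) := by
  obtain ⟨v₀⟩ := id ‹Nonempty V›
  simp only [unitTensor, Finset.sum_apply, simpleTensor, Pi.single_apply, Fintype.prod_boole]
  by_cases h : ∀ u v, x u = x v
  · rw [boole_true h, Finset.sum_eq_single (x v₀)]
    · simp [h _ v₀]
    · intro j _ hj
      rw [if_neg fun h' => hj (h' v₀).symm]
    · simp
  · rw [boole_false h]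
    exact Finset.sum_eq_zero fun j _ => if_neg fun h' => h fun u v => by rw [h', h']

theorem sum_unitTensor_mul [Nonempty V] {r : ℕ} (g : (V → Fin r) → ℂ) :
    ∑ c, unitTensor V r c * g c = ∑ j, g fun _ => j := by
  classical
  simp only [unitTensor, Finset.sum_apply, simpleTensor, Pi.single_apply, Fintype.prod_boole,
    Finset.sum_mul]
  rw [Finset.sum_comm]
  refine Finset.sum_congr rfl fun j _ => ?_
  rw [Finset.sum_eq_single fun _ => j]
  · simp
  · intro b _ hb
    rw [if_neg fun h => hb (funext h), zero_mul]
  · simp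

/-- Rank at most `r` is the same as being a restriction of the unit tensor `T_r`. -/
theorem restricts_unitTensor_iff [Nonempty V] {κ : V → Type*} {r : ℕ} {ψ : Tensor κ} :
    Restricts (unitTensor V r) ψ ↔ RankLE ψ r := by
  have key : ∀ (A : ∀ v, Matrix (κ v) (Fin r) ℂ) x,
      applyMaps A (unitTensor V r) x = ∑ j, ∏ v, A v (x v) j := fun A x => by
    simp only [applyMaps, mul_comm _ (unitTensor V r _)]
    exact sum_unitTensor_mul fun c => ∏ v, A v (x v) (c v)
  constructor
  · rintro ⟨A, rfl⟩
    exact ⟨fun j v k => A v k j, key A⟩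
  · rintro ⟨u, hu⟩
    exact ⟨fun v => Matrix.of fun k j => u j v k, funext fun x => by rw [key, hu]; rfl⟩

/-- `T_2^{⊗ m}` is `T_{2 ^ m}` up to relabelling of the basis. -/
theorem RankLE.restricts_tensorPow [Nonempty V] {κ : V → Type*} {m : ℕ} {ψ : Tensor κ}
    (h : RankLE ψ (2 ^ m)) : Restricts (tensorPow (unitTensor V 2) m) ψ := by
  classical
  obtain ⟨A, rfl⟩ := restricts_unitTensor_iff.2 h
  refine ⟨fun v => (A v).submatrix id finFunctionFinEquiv, funext fun x => ?_⟩
  simp only [applyMaps]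
  refine (Fintype.sum_equiv (Equiv.arrowCongr (Equiv.refl V) finFunctionFinEquiv) _ _
    fun c => ?_).symm
  congr 1
  simp only [tensorPow, unitTensor_apply, prod_boole]
  simp only [Equiv.arrowCongr_apply, Function.comp, Equiv.refl_symm, Equiv.refl_apply,
    EmbeddingLike.apply_eq_iff_eq]
  exact boole_congr ⟨fun h u v => funext fun i => h i u v, fun h i u v => congrFun (h u v) i⟩

theorem borderRank_degenerates [Nonempty V] {κ : V → Type*} [∀ v, Fintype (κ v)]
    (ψ : Tensor κ) : Degenerates (unitTensor V (borderRank ψ)) ψ := by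
  obtain ⟨L, hL⟩ := exists_rankLE ψ
  refine Nat.sInf_mem (s := {r : ℕ | Degenerates (unitTensor V r) ψ}) ⟨L, ?_⟩
  rw [Set.mem_ofPred_eq, Degenerates, zariskiClosure, MvPolynomial.mem_zeroLocus_iff]
  exact fun p hp => MvPolynomial.mem_vanishingIdeal_iff.1 hp _ (restricts_unitTensor_iff.2 hL)

end Unit

/-! ### Powers of degenerations have small rank -/

section Degeneration

/-- The values at `χ` of all monomials whose degree in each variable is at most `N`. -/
def monomialVector {I : Type*} [Fintype I] (N : ℕ) (χ : I → ℂ) : (I → Fin (N + 1)) → ℂ :=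
  fun c => ∏ i, χ i ^ (c i : ℕ)

/-- A linear functional that vanishes on all monomial vectors of points of `S` is a polynomial
that vanishes on `S`, hence on the Zariski closure of `S`. -/
theorem monomialVector_mem_span {I : Type*} [Fintype I] {S : Set (I → ℂ)} {ψ : I → ℂ}
    (h : ψ ∈ zariskiClosure S) (N : ℕ) :
    monomialVector N ψ ∈ Submodule.span ℂ (monomialVector N '' S) := by
  classical
  by_contra hn
  obtain ⟨F, hF, hS⟩ := Submodule.exists_le_ker_of_notMem hn
  let P : MvPolynomial I ℂ := ∑ c : I → Fin (N + 1),
    MvPolynomial.C (F fun j => if c = j then 1 else 0) * ∏ i, MvPolynomial.X i ^ (c i : ℕ)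
  have hP : ∀ χ : I → ℂ, MvPolynomial.aeval χ P = F (monomialVector N χ) := fun χ => by
    rw [LinearMap.pi_apply_eq_sum_univ F]
    simp [P, monomialVector, mul_comm]
  refine hF ?_
  rw [← hP]
  refine MvPolynomial.mem_zeroLocus_iff.1 h P (MvPolynomial.mem_vanishingIdeal_iff.2 fun χ hχ => ?_)
  rw [hP]
  exact hS (Submodule.subset_span (Set.mem_image_of_mem _ hχ))

variable {V : Type*} [Fintype V] [DecidableEq V] {κ : V → Type*} [∀ v, Fintype (κ v)]

/-- The coefficients of `χ^{⊗ N}` are monomials of degree `N` in those of `χ`. -/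
theorem exists_tensorPow_eq_monomialVector (N : ℕ) (x : ∀ v, Fin N → κ v) :
    ∃ c : (∀ v, κ v) → Fin (N + 1), ∀ χ : Tensor κ, tensorPow χ N x = monomialVector N χ c := by
  classical
  refine ⟨fun i => ⟨(Finset.univ.filter fun j : Fin N => (fun v => x v j) = i).card,
    Nat.lt_succ_of_le ((Finset.card_le_univ _).trans_eq (Fintype.card_fin N))⟩, fun χ => ?_⟩
  simp only [tensorPow, monomialVector]
  rw [← Finset.prod_fiberwise Finset.univ fun (j : Fin N) v => x v j]
  refine Finset.prod_congr rfl fun i _ => ?_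
  rw [← Finset.prod_const]
  exact Finset.prod_congr rfl fun j hj => congrArg χ (Finset.mem_filter.1 hj).2

/-- If `T_R` degenerates to `ψ`, then the rank of `ψ^{⊗ N}` exceeds `R ^ N` by a polynomial factor
at most, because `ψ^{⊗ N}` is a combination of that many powers of restrictions of `T_R`. -/
theorem Degenerates.rankLE_tensorPow [Nonempty V] {R : ℕ} {ψ : Tensor κ}
    (h : Degenerates (unitTensor V R) ψ) (N : ℕ) :
    RankLE (tensorPow ψ N) ((N + 1) ^ Fintype.card (∀ v, κ v) * R ^ N) := by
  classical
  have hmem := monomialVector_mem_span h N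
  obtain ⟨b, hb, hspan, hli⟩ := exists_linearIndependent ℂ
    (monomialVector N '' {χ : Tensor κ | Restricts (unitTensor V R) χ})
  have := hli.finite
  have := Fintype.ofFinite b
  have hcard : Fintype.card b ≤ (N + 1) ^ Fintype.card (∀ v, κ v) := by
    simpa using hli.fintype_card_le_finrank
  rw [← hspan, ← Subtype.range_coe (s := b), Submodule.mem_span_range_iff_exists_fun] at hmem
  obtain ⟨a, ha⟩ := hmem
  choose χ hχ hχb using fun k : b => hb k.2
  have hψ : tensorPow ψ N = ∑ k, a k • tensorPow (χ k) N := by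
    ext x
    obtain ⟨c, hc⟩ := exists_tensorPow_eq_monomialVector (κ := κ) N x
    simp only [Finset.sum_apply, Pi.smul_apply, hc, ← ha, hχb]
  rw [hψ]
  exact RankLE.sum_smul (fun k => (restricts_unitTensor_iff.1 (hχ k)).pow N) a hcard

end Degeneration

/-! ### Copies of graph tensors -/

section Copies

variable {V : Type*} [Fintype V] [DecidableEq V] {G : SimpleGraph V} [DecidableRel G.Adj]

/-- A family of basis labels at the vertices is consistent if the two ends of each edge `e` carry
the same index in `[f e]`, that is, if it comes from an element of `∏_e [f e]`. -/
def Consistent {f : G.edgeSet → ℕ} (x : ∀ v, LegIndex G f v) : Prop :=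
  ∀ (e : G.edgeSet) (u v : V) (hu : u ∈ e.1) (hv : v ∈ e.1), x u ⟨e, hu⟩ = x v ⟨e, hv⟩

theorem graphTensor_apply {f : G.edgeSet → ℕ} (x : ∀ v, LegIndex G f v) :
    graphTensor G f x = boole (Consistent x) := by
  simp only [graphTensor, Finset.sum_apply, simpleTensor, Pi.single_apply, Fintype.prod_boole]
  by_cases h : Consistent x
  · let i₀ : ∀ e : G.edgeSet, Fin (f e) := fun e => x (Quot.out e.1).1 ⟨e, Sym2.out_fst_mem e.1⟩
    rw [boole_true h, Finset.sum_eq_single i₀]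
    · exact if_pos fun v => funext fun e => h e.1 _ _ e.2 _
    · intro j _ hj
      refine if_neg fun h' => hj (funext fun e => ?_)
      simp only [i₀, h']
    · simp
  · rw [boole_false h]
    refine Finset.sum_eq_zero fun j _ => if_neg fun h' => h fun e u v hu hv => ?_
    simp only [h']

/-- The tensor `T_C ⊗ T_f(G)`, which is the direct sum of `C` copies of `T_f(G)`. -/
def copies (G : SimpleGraph V) [DecidableRel G.Adj] (C : ℕ) (f : G.edgeSet → ℕ) :
    Tensor fun v => Fin C × LegIndex G f v :=
  fun x => unitTensor V C (fun v => (x v).1) * graphTensor G f fun v => (x v).2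

theorem rankLE_copies_one (C : ℕ) {f : G.edgeSet → ℕ} (hf : ∀ e, f e = 1) :
    RankLE (copies G C f) C := by
  classical
  obtain rfl : f = fun _ => 1 := funext hf
  have h : RankLE (unitTensor V C) C := ⟨fun j v => Pi.single j 1, fun x => by
    simp [unitTensor, simpleTensor]⟩
  convert h.comp (κ' := fun v => Fin C × LegIndex G (fun _ => 1) v) (fun v k => k.1) using 2 with x
  rw [copies, graphTensor_apply, boole_true, mul_one]
  exact fun e u v hu hv => Subsingleton.elim _ _

variable [Nonempty V]

theorem copies_apply {C : ℕ} {f : G.edgeSet → ℕ} (x : ∀ v, Fin C × LegIndex G f v) :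
    copies G C f x = boole ((∀ u v, (x u).1 = (x v).1) ∧ Consistent fun v => (x v).2) := by
  rw [copies, unitTensor_apply, graphTensor_apply, boole_and]

theorem RankLE.copies_mono {C C' : ℕ} {f f' : G.edgeSet → ℕ} {L : ℕ} (h : RankLE (copies G C f) L)
    (hC : C' ≤ C) (hf : f' ≤ f) : RankLE (copies G C' f') L := by
  classical
  convert h.comp (κ' := fun v => Fin C' × LegIndex G f' v)
    (fun v k => (k.1.castLE hC, fun e => (k.2 e).castLE (hf e.1))) using 2 with x
  simp only [copies_apply, Consistent, Fin.castLE_inj]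

omit [Fintype V] [DecidableEq V] [Nonempty V] in
theorem fin_mul_eq_iff {m n : ℕ} {a b : Fin (m * n)} : a = b ↔
    (finProdFinEquiv.symm a).1 = (finProdFinEquiv.symm b).1 ∧
      (finProdFinEquiv.symm a).2 = (finProdFinEquiv.symm b).2 := by
  rw [← Prod.ext_iff, EmbeddingLike.apply_eq_iff_eq]

theorem RankLE.copies_mul {C C' : ℕ} {f f' : G.edgeSet → ℕ} {L L' : ℕ}
    (h : RankLE (copies G C f) L) (h' : RankLE (copies G C' f') L') :
    RankLE (copies G (C * C') (f * f')) (L * L') := by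
  classical
  convert (h.mul h').comp (κ' := fun v => Fin (C * C') × LegIndex G (f * f') v)
    (fun v k => (((finProdFinEquiv.symm k.1).1, fun e => (finProdFinEquiv.symm (k.2 e)).1),
      ((finProdFinEquiv.symm k.1).2, fun e => (finProdFinEquiv.symm (k.2 e)).2))) using 2 with x
  simp only [copies_apply, Consistent, ← boole_and]
  refine boole_congr ⟨fun ⟨h1, h2⟩ => ⟨⟨fun u v => ?_, fun e u v hu hv => ?_⟩, fun u v => ?_,
    fun e u v hu hv => ?_⟩, fun ⟨⟨h1, h2⟩, h3, h4⟩ => ⟨fun u v => ?_, fun e u v hu hv => ?_⟩⟩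
  · rw [h1 u v]
  · rw [h2 e u v hu hv]
  · rw [h1 u v]
  · rw [h2 e u v hu hv]
  · exact fin_mul_eq_iff.2 ⟨h1 u v, h3 u v⟩
  · exact fin_mul_eq_iff.2 ⟨h2 e u v hu hv, h4 e u v hu hv⟩

/-- Ranks of copies of graph tensors are invariant under automorphisms of the graph. -/
theorem RankLE.copies_comp_iso {C : ℕ} {f : G.edgeSet → ℕ} {L : ℕ} (h : RankLE (copies G C f) L)
    (σ : G ≃g G) : RankLE (copies G C (f ∘ σ.mapEdgeSet)) L := by
  classical
  obtain ⟨u, hu⟩ := h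
  have hmem : ∀ {v w : V} (_ : σ v = w) (e : G.edgeSet), w ∈ e.1 →
      v ∈ (σ.mapEdgeSet.symm e).1 := fun {v w} hw e he => by
    obtain ⟨e', rfl⟩ := σ.mapEdgeSet.surjective e
    rw [Equiv.symm_apply_apply]
    obtain ⟨a, ha, hav⟩ := Sym2.mem_map.1 (show w ∈ Sym2.map σ e'.1 from he)
    rwa [← σ.injective (hav.trans hw.symm)]
  have hcast : ∀ e, (f ∘ σ.mapEdgeSet) (σ.mapEdgeSet.symm e) = f e := fun e =>
    congrArg f (σ.mapEdgeSet.apply_symm_apply e)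
  -- transport of basis labels from the leg at `v` to the leg at `σ v = w`
  let β : ∀ v w : V, σ v = w → Fin C × LegIndex G (f ∘ σ.mapEdgeSet) v → Fin C × LegIndex G f w :=
    fun v w hw k => (k.1, fun e =>
      Fin.cast (hcast e.1) (k.2 ⟨σ.mapEdgeSet.symm e.1, hmem hw e.1 e.2⟩))
  refine ⟨fun j v k => u j (σ v) (β v (σ v) rfl k), fun x => ?_⟩
  let y : ∀ w, Fin C × LegIndex G f w := fun w => β (σ.symm w) w (by simp) (x (σ.symm w))
  have hy : ∀ v, y (σ v) = β v (σ v) rfl (x v) := fun v => by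
    have : ∀ v' (hv : σ v' = σ v), v' = v → β v' (σ v) hv (x v') = β v (σ v) rfl (x v) := by
      rintro _ _ rfl; rfl
    exact this (σ.symm (σ v)) (σ.apply_symm_apply _) (σ.symm_apply_apply v)
  have hprod : ∀ j, ∏ v, u j (σ v) (β v (σ v) rfl (x v)) = ∏ w, u j w (y w) := fun j => by
    rw [← Equiv.prod_comp σ.toEquiv fun w => u j w (y w)]
    exact Finset.prod_congr rfl fun v _ => by rw [← hy]; rfl
  simp only [hprod, ← hu, copies_apply]
  refine boole_congr (and_congr ⟨fun H a b => H _ _, fun H a b => ?_⟩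
    ⟨fun H e a b ha hb => ?_, fun H e a b ha hb => ?_⟩)
  · have := H (σ a) (σ b)
    rwa [hy, hy] at this
  · exact congrArg (Fin.cast (hcast e)) (H (σ.mapEdgeSet.symm e) _ _ _ _)
  · have hσ : ∀ {v}, v ∈ e.1 → σ v ∈ (σ.mapEdgeSet e).1 := fun hv =>
      Sym2.mem_map.2 ⟨_, hv, rfl⟩
    have := H (σ.mapEdgeSet e) (σ a) (σ b) (hσ ha) (hσ hb)
    simp only [hy, β, Fin.cast_inj] at this
    have key : ∀ (e' : G.edgeSet) (_ : e' = e) (ha' : a ∈ e'.1) (hb' : b ∈ e'.1),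
        (x a).2 ⟨e', ha'⟩ = (x b).2 ⟨e', hb'⟩ → (x a).2 ⟨e, ha⟩ = (x b).2 ⟨e, hb⟩ := by
      rintro _ rfl _ _ h
      exact h
    exact key _ (σ.mapEdgeSet.symm_apply_apply e) _ _ this

theorem RankLE.copies_prod_iso {C : ℕ} {f : G.edgeSet → ℕ} {L : ℕ} (h : RankLE (copies G C f) L)
    (s : Finset (G ≃g G)) :
    RankLE (copies G (C ^ s.card) fun e => ∏ σ ∈ s, f (σ.mapEdgeSet e)) (L ^ s.card) := by
  classical
  induction s using Finset.induction_on with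
  | empty => exact rankLE_copies_one 1 fun e => Finset.prod_empty
  | insert σ s hσ ih =>
    rw [Finset.card_insert_of_notMem hσ, pow_succ', pow_succ']
    have heq : (fun e => ∏ τ ∈ insert σ s, f (τ.mapEdgeSet e)) =
        (f ∘ σ.mapEdgeSet) * fun e => ∏ τ ∈ s, f (τ.mapEdgeSet e) :=
      funext fun e => Finset.prod_insert hσ
    rw [heq]
    exact (h.copies_comp_iso σ).copies_mul ih

/-- The inductive step that trades copies for powers: `L ≤ Q C` simple terms for `C` copies of
`T_f` turn `C` copies of `T_f ⊗ T_f'` into `Q` groups, each a restriction of `C` copies of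
`T_f'`. -/
theorem RankLE.copies_mul_of_le {C : ℕ} {f f' : G.edgeSet → ℕ} {L L' Q : ℕ}
    (h : RankLE (copies G C f) L) (h' : RankLE (copies G C f') L') (hL : L ≤ Q * C) :
    RankLE (copies G C (f * f')) (Q * L') := by
  classical
  obtain ⟨u, hu⟩ := h.mono hL
  obtain ⟨u', hu'⟩ := h'
  let a : ∀ v, Fin C × LegIndex G (f * f') v → Fin C × LegIndex G f v :=
    fun v k => (k.1, fun e => (finProdFinEquiv.symm (k.2 e)).1)
  let b : ∀ v, Fin C × LegIndex G (f * f') v → LegIndex G f' v :=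
    fun v k e => (finProdFinEquiv.symm (k.2 e)).2
  have hsplit : ∀ x, copies G C (f * f') x =
      copies G C f (fun v => a v (x v)) * graphTensor G f' (fun v => b v (x v)) := fun x => by
    simp only [copies_apply, graphTensor_apply, Consistent, ← boole_and]
    refine boole_congr ⟨fun ⟨h1, h2⟩ => ⟨⟨h1, fun e u v hu hv => ?_⟩, fun e u v hu hv => ?_⟩,
      fun ⟨⟨h1, h2⟩, h3⟩ => ⟨h1, fun e u v hu hv => ?_⟩⟩
    · simp only [a, h2 e u v hu hv]
    · simp only [b, h2 e u v hu hv]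
    · exact fin_mul_eq_iff.2 ⟨h2 e u v hu hv, h3 e u v hu hv⟩
  refine RankLE.of_fintype (J := Fin Q × Fin L')
    (fun j v k => ∑ c, u (finProdFinEquiv (j.1, c)) v (a v k) * u' j.2 v (c, b v k))
    (by simp) fun x => ?_
  rw [hsplit, hu, ← Equiv.sum_comp finProdFinEquiv, Fintype.sum_prod_type, Fintype.sum_prod_type,
    Finset.sum_mul]
  refine Finset.sum_congr rfl fun q _ => ?_
  simp only [Fintype.prod_sum, Finset.prod_mul_distrib]
  rw [Finset.sum_comm]
  simp only [← Finset.mul_sum, ← hu' fun v => (_, b v (x v))]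
  simp only [copies, ← mul_assoc, ← Finset.sum_mul]
  simp only [mul_comm _ (unitTensor V C _)]
  rw [sum_unitTensor_mul fun c => ∏ v, u (finProdFinEquiv (q, c v)) v (a v (x v))]

/-- If `C` copies of `T_f` have rank at most `Q C`, then even `C` copies of `T_f^{⊗ s}` have rank at
most `Q ^ s C`. -/
theorem RankLE.copies_pow {C : ℕ} {f : G.edgeSet → ℕ} {L Q : ℕ} (h : RankLE (copies G C f) L)
    (hL : L ≤ Q * C) (s : ℕ) : RankLE (copies G C (f ^ s)) (Q ^ s * C) := by
  induction s with
  | zero => rw [pow_zero, pow_zero, one_mul]; exact rankLE_copies_one C fun e => rfl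
  | succ s ih =>
    rw [pow_succ', pow_succ', mul_assoc]
    exact h.copies_mul_of_le ih hL

/-- `T(G)^{⊗ k}` is a restriction of `T_f(G)` as soon as all `f e ≥ 2 ^ k`. -/
theorem RankLE.tensorPow_graphTensor {f : G.edgeSet → ℕ} {L k : ℕ} (h : RankLE (copies G 1 f) L)
    (hf : ∀ e, 2 ^ k ≤ f e) : RankLE (tensorPow (graphTensor G fun _ => 2) k) L := by
  classical
  convert (h.copies_mono (f' := fun _ => 2 ^ k) le_rfl hf).comp
    (κ' := fun v => Fin k → LegIndex G (fun _ => 2) v)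
    (fun v x => (0, fun e => finFunctionFinEquiv fun j => x j e)) using 2 with x
  simp only [copies_apply, tensorPow, graphTensor_apply, prod_boole, Consistent,
    EmbeddingLike.apply_eq_iff_eq, implies_true, true_and]
  exact boole_congr ⟨fun H e u v hu hv => funext fun j => H j e u v hu hv,
    fun H j e u v hu hv => congrFun (H e u v hu hv) j⟩

end Copies

/-! ### Direct sums of graph tensors -/

section DirectSum

variable {V : Type*} [Fintype V] [DecidableEq V] [Nonempty V] {p : ℕ}

omit [Fintype V] [DecidableEq V] in
theorem directSum_apply_mk {ι : Fin p → V → Type*} (φ : ∀ i, Tensor (ι i)) (i : Fin p)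
    (y : ∀ v, ι i v) : directSum φ (fun v => ⟨i, y v⟩) = φ i y := by
  obtain ⟨v₀⟩ := id ‹Nonempty V›
  rw [directSum, Finset.sum_eq_single i]
  · refine Function.Injective.extend_apply (fun a b hab => ?_) _ _ _
    funext v
    simpa using congrFun hab v
  · rintro j - hj
    rw [Function.extend_apply', Pi.zero_apply]
    rintro ⟨a, ha⟩
    exact hj (congrArg Sigma.fst (congrFun ha v₀))
  · simp

omit [Fintype V] [DecidableEq V] [Nonempty V] in
theorem directSum_eq_zero {ι : Fin p → V → Type*} (φ : ∀ i, Tensor (ι i))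
    (x : ∀ v, Σ i, ι i v) {u v : V} (h : (x u).1 ≠ (x v).1) : directSum φ x = 0 := by
  refine Finset.sum_eq_zero fun i _ => ?_
  rw [Function.extend_apply', Pi.zero_apply]
  rintro ⟨a, rfl⟩
  exact h rfl

variable {G : SimpleGraph V} [DecidableRel G.Adj]

/-- The `N`-th power of `⨁_i T_{f i}(G)` contains, for each set of words `w` over the summands for
which the products `F e = ∏_j f (w j) e` agree, one copy of `T_F(G)` per word. -/
theorem RankLE.copies_of_words {f : Fin p → G.edgeSet → ℕ} {N C L : ℕ} {F : G.edgeSet → ℕ}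
    (h : RankLE (tensorPow (directSum fun i => graphTensor G (f i)) N) L)
    (w : Fin C → Fin N → Fin p) (hw : Function.Injective w)
    (hF : ∀ c e, ∏ j, f (w c j) e = F e) : RankLE (copies G C F) L := by
  classical
  let β : ∀ c e, Fin (F e) ≃ ∀ j, Fin (f (w c j) e) := fun c e =>
    (finCongr (hF c e).symm).trans finPiFinEquiv.symm
  convert h.comp (κ' := fun v => Fin C × LegIndex G F v)
    (fun v k j => ⟨w k.1 j, fun e => β k.1 e.1 (k.2 e) j⟩) using 2 with x
  by_cases hx : ∀ u v, (x u).1 = (x v).1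
  · obtain ⟨v₀⟩ := id ‹Nonempty V›
    obtain ⟨c, y, rfl⟩ : ∃ c, ∃ y : ∀ v, LegIndex G F v, x = fun v => (c, y v) :=
      ⟨(x v₀).1, fun v => (x v).2, funext fun v => Prod.ext (hx v v₀) rfl⟩
    simp only [tensorPow]
    simp only [directSum_apply_mk (fun i => graphTensor G (f i)) _
      (fun v (e : {e : G.edgeSet // v ∈ e.1}) => β c e.1 (y v e) _)]
    simp only [copies_apply, graphTensor_apply, prod_boole, Consistent, implies_true,
      true_and]
    congr 1
    exact propext ⟨fun H j e u v hu hv => by rw [H e u v hu hv],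
      fun H e u v hu hv => (β c e).injective (funext fun j => H j e u v hu hv)⟩
  · rw [copies_apply, boole_false fun H => hx H.1]
    push Not at hx
    obtain ⟨u, v, huv⟩ := hx
    obtain ⟨j, hj⟩ := Function.ne_iff.1 (hw.ne huv)
    exact (Finset.prod_eq_zero (Finset.mem_univ j) (directSum_eq_zero _ _ (u := u) (v := v) hj)).symm

/-- If the flattening of `ψ` at the leg `u` contains an identity block of size `p` and `T_r`
degenerates to `ψ`, then `r ≥ p`: the flattenings of restrictions of `T_r` have rank at most `r`,
and the vanishing of a minor is a polynomial condition, so it passes to the Zariski closure. -/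
theorem Degenerates.le_of_flattening {κ : V → Type*} {ψ : Tensor κ} {r : ℕ}
    (h : Degenerates (unitTensor V r) ψ) (u : V) (y : Fin p → ∀ v, κ v)
    (hy : ∀ k l, ψ (Function.update (y l) u (y k u)) = if k = l then 1 else 0) : p ≤ r := by
  by_contra! hlt
  let M : Matrix (Fin p) (Fin p) (MvPolynomial (∀ v, κ v) ℂ) :=
    Matrix.of fun k l => MvPolynomial.X (Function.update (y l) u (y k u))
  have hM : ∀ χ : Tensor κ, MvPolynomial.aeval χ M.det =
      (Matrix.of fun k l => χ (Function.update (y l) u (y k u))).det := fun χ => by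
    rw [AlgHom.map_det]
    congr 1
    ext k l
    simp [M]
  have hzero : MvPolynomial.aeval ψ M.det = 0 := by
    refine MvPolynomial.mem_zeroLocus_iff.1 h _ (MvPolynomial.mem_vanishingIdeal_iff.2 ?_)
    intro χ hχ
    obtain ⟨a, ha⟩ := restricts_unitTensor_iff.1 hχ
    rw [hM]
    let A : Matrix (Fin p) (Fin r) ℂ := Matrix.of fun k j => a j u (y k u)
    let B : Matrix (Fin r) (Fin p) ℂ :=
      Matrix.of fun j l => ∏ v ∈ Finset.univ.erase u, a j v (y l v)
    have hmul : (Matrix.of fun k l => χ (Function.update (y l) u (y k u))) = A * B := by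
      ext k l
      simp only [A, B, Matrix.of_apply, Matrix.mul_apply, ha]
      refine Finset.sum_congr rfl fun j _ => ?_
      rw [← Finset.mul_prod_erase _ _ (Finset.mem_univ u), Function.update_self]
      congr 1
      refine Finset.prod_congr rfl fun v hv => ?_
      rw [Function.update_of_ne (Finset.ne_of_mem_erase hv)]
    rw [hmul]
    by_contra hdet
    have h1 := Matrix.rank_of_isUnit _ ((Matrix.isUnit_iff_isUnit_det (A * B)).2 (Ne.isUnit hdet))
    have h2 := (Matrix.rank_mul_le_left A B).trans (Matrix.rank_le_width A)
    rw [h1, Fintype.card_fin] at h2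
    omega
  rw [hM] at hzero
  simp only [hy] at hzero
  exact one_ne_zero ((Matrix.det_one (n := Fin p) (R := ℂ)).symm.trans hzero)

theorem le_borderRank_directSum {f : Fin p → G.edgeSet → ℕ} (hf : ∀ i e, 0 < f i e)
    {u v : V} (huv : u ≠ v) :
    p ≤ borderRank (directSum fun i => graphTensor G (f i)) := by
  classical
  refine (borderRank_degenerates _).le_of_flattening u
    (fun i v => ⟨i, fun e => ⟨0, hf i e.1⟩⟩) fun k l => ?_
  split_ifs with h
  · subst h
    rw [Function.update_eq_self, directSum_apply_mk (fun i => graphTensor G (f i)) k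
      (fun v (e : {e : G.edgeSet // v ∈ e.1}) => ⟨0, hf k e.1⟩), graphTensor_apply, boole_true]
    exact fun e _ _ _ _ => rfl
  · refine directSum_eq_zero _ _ (u := u) (v := v) ?_
    rwa [Function.update_self, Function.update_of_ne huv.symm]

end DirectSum

/-! ### Words of equal type -/

/-- Among the words `w` of length `N` over `p` letters, those with the most frequent letter counts,
weighted by `∏_j (∏_e f (w j) e) ^ τ`, carry a fraction of at least `(N + 1) ^ (-p)` of the total
weight, since there are at most `(N + 1) ^ p` letter counts. -/
theorem exists_words {E : Type*} [Fintype E] {p : ℕ} (hp : 1 ≤ p) (f : Fin p → E → ℕ)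
    (hf : ∀ i, 2 ≤ ∏ e, f i e) (τ : ℝ) (N : ℕ) :
    ∃ (C : ℕ) (w : Fin C → Fin N → Fin p) (F : E → ℕ), Function.Injective w ∧
      (∀ c e, ∏ j, f (w c j) e = F e) ∧ 1 ≤ C ∧ 2 ^ N ≤ ∏ e, F e ∧
      (∑ i, (∏ e, (f i e : ℝ)) ^ τ) ^ N ≤ (N + 1) ^ p * (C * (∏ e, (F e : ℝ)) ^ τ) := by
  classical
  have hpos : ∀ i, 0 < (∏ e, (f i e : ℝ)) := fun i => by
    have := hf i
    rw [← Nat.cast_prod]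
    exact_mod_cast (by omega : 0 < ∏ e, f i e)
  let t : (Fin N → Fin p) → Fin p → Fin (N + 1) := fun w i =>
    ⟨(Finset.univ.filter fun j => w j = i).card,
      Nat.lt_succ_of_le ((Finset.card_le_univ _).trans_eq (Fintype.card_fin N))⟩
  have hsum : ∑ w : Fin N → Fin p, ∏ j, (∏ e, (f (w j) e : ℝ)) ^ τ =
      (∑ i, (∏ e, (f i e : ℝ)) ^ τ) ^ N := by
    rw [Fintype.sum_pow]
  have hr : 0 < (∑ i, (∏ e, (f i e : ℝ)) ^ τ) ^ N := by
    refine pow_pos (Finset.sum_pos (fun i _ => Real.rpow_pos_of_pos (hpos i) τ) ?_) N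
    exact ⟨⟨0, hp⟩, Finset.mem_univ _⟩
  obtain ⟨y, -, hy⟩ := Finset.exists_le_sum_fiber_of_maps_to_of_nsmul_le_sum
    (s := (Finset.univ : Finset (Fin N → Fin p))) (t := Finset.univ) (f := t)
    (w := fun w => ∏ j, (∏ e, (f (w j) e : ℝ)) ^ τ)
    (b := (∑ i, (∏ e, (f i e : ℝ)) ^ τ) ^ N / (N + 1) ^ p) (fun _ _ => Finset.mem_univ _)
    ⟨fun _ => 0, Finset.mem_univ _⟩ (by
      rw [hsum, nsmul_eq_mul, Finset.card_univ, Fintype.card_fun, Fintype.card_fin,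
        Fintype.card_fin]
      push_cast
      rw [mul_div_cancel₀ _ (by positivity)])
  -- the words whose letter counts are the given ones `y`
  set s := Finset.univ.filter fun w => t w = y
  let F : E → ℕ := fun e => ∏ i, f i e ^ (y i : ℕ)
  have hF : ∀ w ∈ s, ∀ e, ∏ j, f (w j) e = F e := fun w hw e => by
    rw [← Finset.prod_fiberwise Finset.univ w]
    refine Finset.prod_congr rfl fun i _ => ?_
    rw [← (Finset.mem_filter.1 hw).2, ← Finset.prod_const]
    exact Finset.prod_congr rfl fun j hj => by rw [(Finset.mem_filter.1 hj).2]
  have hA : ∀ w ∈ s, ∏ j, ∏ e, f (w j) e = ∏ e, F e := fun w hw => by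
    rw [Finset.prod_comm]
    exact Finset.prod_congr rfl fun e _ => hF w hw e
  have hterm : ∑ w ∈ s, ∏ j, (∏ e, (f (w j) e : ℝ)) ^ τ = s.card * (∏ e, (F e : ℝ)) ^ τ := by
    rw [← nsmul_eq_mul]
    refine Finset.sum_eq_card_nsmul fun w hw => ?_
    rw [Real.finsetProd_rpow _ _ fun j _ => (hpos _).le]
    congr 1
    exact_mod_cast hA w hw
  rw [hterm, div_le_iff₀ (by positivity), mul_comm] at hy
  have hs0 : s.Nonempty := by
    rw [← Finset.card_pos]
    by_contra h0
    rw [Nat.eq_zero_of_not_pos h0] at hy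
    simp only [Nat.cast_zero, zero_mul, mul_zero] at hy
    exact absurd hr hy.not_gt
  refine ⟨s.card, fun c => (s.equivFin.symm c : Fin N → Fin p), F,
    Subtype.val_injective.comp s.equivFin.symm.injective,
    fun c => hF _ (s.equivFin.symm c).2, hs0.card_pos, ?_, hy⟩
  obtain ⟨w, hw⟩ := hs0
  rw [← hA w hw]
  simpa using Finset.pow_card_le_prod Finset.univ (fun j => ∏ e, f (w j) e) 2 fun j _ => hf (w j)

/-! ### Bounds on the exponent -/

section Exponent

variable {V : Type*} [Fintype V] [DecidableEq V] [Nonempty V] {G : SimpleGraph V}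
  [DecidableRel G.Adj]

/-- If `C` copies of the uniform graph tensor with bonds of size `n` have rank at most `Q C`, then
the exponent of `T(G)` is at most `log_n Q`; the number `C` of copies does not matter. -/
theorem exponent_le_of_rankLE_copies {C L Q n : ℕ} (h : RankLE (copies G C fun _ => n) L)
    (hL : L ≤ Q * C) (hC : 1 ≤ C) (hQ : 1 ≤ Q) (hn : 2 ≤ n) :
    exponent (graphTensor G fun _ => 2) ≤ ((Real.log Q / Real.log n : ℝ) : EReal) := by
  have hn0 : 0 < Real.log n := Real.log_pos (by exact_mod_cast hn)
  have h2 : 0 < Real.log 2 := Real.log_pos (by norm_num)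
  have hQ0 : 0 ≤ Real.log Q := Real.log_nonneg (by exact_mod_cast hQ)
  have hC0 : 0 ≤ Real.log C := Real.log_nonneg (by exact_mod_cast hC)
  set K : ℝ := (Real.log Q + Real.log C) / Real.log 2 + 1 with hK
  have hbound : ∀ k : ℕ, ∃ m : ℕ, (m : ℝ) ≤ Real.log Q / Real.log n * k + K ∧
      copiesNeeded (unitTensor V 2) (graphTensor G fun _ => 2) k ≤ (m : EReal) := fun k => by
    -- `n ^ s ≥ 2 ^ k`, so `T(G)^{⊗ k}` is contained in the `s`-th power of the uniform graph tensor
    set s := ⌈k * Real.log 2 / Real.log n⌉₊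
    have hs1 : k * Real.log 2 / Real.log n ≤ s := Nat.le_ceil _
    have hs2 : (s : ℝ) ≤ k * Real.log 2 / Real.log n + 1 := (Nat.ceil_lt_add_one (by positivity)).le
    set m := ⌈(s * Real.log Q + Real.log C) / Real.log 2⌉₊
    have hm1 : (s * Real.log Q + Real.log C) / Real.log 2 ≤ m := Nat.le_ceil _
    have hm2 : (m : ℝ) ≤ (s * Real.log Q + Real.log C) / Real.log 2 + 1 :=
      (Nat.ceil_lt_add_one (by positivity)).le
    have hpow : 2 ^ k ≤ n ^ s := by
      have : ((2 : ℝ) ^ k) ≤ (n : ℝ) ^ s := by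
        rw [← Real.log_le_log_iff (by positivity) (by positivity), Real.log_pow, Real.log_pow]
        rwa [div_le_iff₀ hn0] at hs1
      exact_mod_cast this
    have hpow' : Q ^ s * C ≤ 2 ^ m := by
      have : (Q : ℝ) ^ s * C ≤ 2 ^ m := by
        rw [← Real.log_le_log_iff (by positivity) (by positivity),
          Real.log_mul (by positivity) (by positivity), Real.log_pow, Real.log_pow]
        rwa [div_le_iff₀ h2] at hm1
      exact_mod_cast this
    refine ⟨m, hm2.trans ?_, iInf₂_le m ?_⟩
    · calc (s * Real.log Q + Real.log C) / Real.log 2 + 1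
          ≤ ((k * Real.log 2 / Real.log n + 1) * Real.log Q + Real.log C) / Real.log 2 + 1 := by
            gcongr
        _ = Real.log Q / Real.log n * k + K := by
            rw [hK]; field_simp; ring
    · refine RankLE.restricts_tensorPow (RankLE.mono ?_ hpow')
      exact ((h.copies_pow hL s).copies_mono hC le_rfl).tensorPow_graphTensor fun e => hpow
  have htend : Filter.Tendsto (fun k : ℕ => ((Real.log Q / Real.log n + K / k : ℝ) : EReal))
      Filter.atTop (nhds ((Real.log Q / Real.log n : ℝ) : EReal)) := by
    refine (continuous_coe_real_ereal.tendsto _).comp ?_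
    simpa using tendsto_const_nhds.add (tendsto_const_div_atTop_nhds_zero_nat K)
  rw [exponent, conversionRate, ← htend.limsup_eq]
  refine Filter.limsup_le_limsup ?_
  filter_upwards [Filter.eventually_ge_atTop 1] with k hk
  have hk0 : (0 : ℝ) < k := by exact_mod_cast hk
  obtain ⟨m, hm, hmk⟩ := hbound k
  refine (EReal.div_le_div_right_of_nonneg (by positivity) hmk).trans ?_
  have : ((m : EReal) / (k : EReal)) = ((m / k : ℝ) : EReal) := by
    rw [EReal.coe_div]; rfl
  rw [this, EReal.coe_le_coe_iff, div_le_iff₀ hk0, add_mul, div_mul_cancel₀ _ hk0.ne']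
  exact hm

omit [DecidableEq V] [Nonempty V] in
/-- In an edge-transitive graph, the product of `F` over the images of an edge under all
automorphisms does not depend on the edge. -/
theorem IsEdgeTransitive.exists_prod_eq (hG : IsEdgeTransitive G) (e₀ : G.edgeSet)
    [Fintype (G ≃g G)] (F : G.edgeSet → ℕ) :
    ∃ n : ℕ, (∀ e, ∏ σ : G ≃g G, F (σ.mapEdgeSet e) = n) ∧
      n ^ Fintype.card G.edgeSet = (∏ e, F e) ^ Fintype.card (G ≃g G) := by
  have hn : ∀ e, ∏ σ : G ≃g G, F (σ.mapEdgeSet e) = ∏ σ : G ≃g G, F (σ.mapEdgeSet e₀) := fun e => by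
    obtain ⟨ρ, hρ⟩ := hG e₀.1 e₀.2 e.1 e.2
    obtain rfl : ρ.mapEdgeSet e₀ = e := Subtype.ext hρ
    refine Fintype.prod_equiv (Equiv.mulRight ρ) _ _ fun σ => congrArg F (Subtype.ext ?_)
    exact Sym2.map_map _
  refine ⟨_, hn, ?_⟩
  calc _ = ∏ e : G.edgeSet, ∏ σ : G ≃g G, F (σ.mapEdgeSet e) := by
        rw [Finset.prod_congr rfl fun e _ => hn e, Finset.prod_const, Finset.card_univ]
    _ = ∏ σ : G ≃g G, ∏ e : G.edgeSet, F (σ.mapEdgeSet e) := Finset.prod_comm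
    _ = _ := by
        rw [Finset.prod_congr rfl fun σ _ => Equiv.prod_comp σ.mapEdgeSet F, Finset.prod_const,
          Finset.card_univ]

/-- A rank bound for `C` copies of a nonuniform graph tensor of an edge-transitive graph bounds the
exponent per edge, after multiplying over all automorphisms of the graph. -/
theorem exponentPerEdge_le_of_rankLE_copies (hG : IsEdgeTransitive G) {C L : ℕ}
    {F : G.edgeSet → ℕ} (h : RankLE (copies G C F) L) (hC : 1 ≤ C) (hCL : C ≤ L)
    (hF : 2 ≤ ∏ e, F e) :
    exponentPerEdge G ≤
      (((Real.log 2 + Real.log (L / C)) / Real.log (∏ e, F e : ℕ) : ℝ) : EReal) := by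
  classical
  have : Finite (G ≃g G) := Finite.of_injective _ (DFunLike.coe_injective (F := G ≃g G))
  have := Fintype.ofFinite (G ≃g G)
  obtain ⟨e₀⟩ : Nonempty G.edgeSet := by
    by_contra hne
    rw [not_nonempty_iff] at hne
    simp at hF
  have hcard : 0 < Fintype.card G.edgeSet := Fintype.card_pos_iff.2 ⟨e₀⟩
  obtain ⟨n, hn, hpow⟩ := hG.exists_prod_eq e₀ F
  set g := Fintype.card (G ≃g G)
  have hg0 : 0 < g := Fintype.card_pos_iff.2 ⟨RelIso.refl _⟩
  have hn2 : 2 ≤ n := by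
    by_contra! hlt
    have h1 : n ^ Fintype.card G.edgeSet ≤ 1 := pow_le_one₀ (Nat.zero_le n) (by omega)
    have h2 : 2 ≤ (∏ e, F e) ^ g := hF.trans (Nat.le_self_pow hg0.ne' _)
    omega
  have hsym : RankLE (copies G (C ^ g) fun _ => n) (L ^ g) := by
    have := h.copies_prod_iso Finset.univ
    rwa [funext hn, Finset.card_univ] at this
  have hC0 : (0 : ℝ) < C := by exact_mod_cast hC
  have hL0 : (0 : ℝ) < L := by exact_mod_cast hC.trans hCL
  have hx1 : (1 : ℝ) ≤ (L / C : ℝ) ^ g := by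
    refine one_le_pow₀ ?_
    rw [one_le_div hC0]
    exact_mod_cast hCL
  set Q := ⌈(L / C : ℝ) ^ g⌉₊
  have hQ1 : (L / C : ℝ) ^ g ≤ Q := Nat.le_ceil _
  have hQ2 : (Q : ℝ) ≤ 2 * (L / C : ℝ) ^ g := by
    have := (Nat.ceil_lt_add_one (zero_le_one.trans hx1)).le
    linarith
  have hQpos : (0 : ℝ) < Q := by linarith
  have hLQ : L ^ g ≤ Q * C ^ g := by
    rw [div_pow, div_le_iff₀ (by positivity)] at hQ1
    exact_mod_cast hQ1
  have hexp := exponent_le_of_rankLE_copies hsym hLQ (Nat.one_le_pow _ _ hC)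
    (by exact_mod_cast hQpos) hn2
  have hA : 0 < Real.log (∏ e, F e : ℕ) := Real.log_pos (by exact_mod_cast hF)
  have hlog : Fintype.card G.edgeSet * Real.log n = g * Real.log (∏ e, F e : ℕ) := by
    rw [← Real.log_pow, ← Real.log_pow]
    exact_mod_cast congrArg (fun k : ℕ => Real.log k) hpow
  have hlogn : 0 < Real.log n := Real.log_pos (by exact_mod_cast hn2)
  have hcardR : (0 : ℝ) < Fintype.card G.edgeSet := by exact_mod_cast hcard
  have hgR : (1 : ℝ) ≤ g := by exact_mod_cast hg0
  have hlogQ : Real.log Q ≤ g * (Real.log 2 + Real.log (L / C)) := by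
    have h2 : 0 ≤ Real.log 2 := Real.log_nonneg (by norm_num)
    calc Real.log Q ≤ Real.log (2 * (L / C : ℝ) ^ g) := Real.log_le_log hQpos hQ2
      _ = Real.log 2 + g * Real.log (L / C) := by
          rw [Real.log_mul (by norm_num) (by positivity), Real.log_pow]
      _ ≤ _ := by nlinarith
  refine (EReal.div_le_div_right_of_nonneg (by positivity) hexp).trans ?_
  have hcast : (((Real.log Q / Real.log n : ℝ) : EReal) / (Fintype.card G.edgeSet : EReal)) =
      ((Real.log Q / Real.log n / Fintype.card G.edgeSet : ℝ) : EReal) := by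
    rw [EReal.coe_div _ (Fintype.card G.edgeSet : ℝ)]; rfl
  rw [hcast, EReal.coe_le_coe_iff, div_div, mul_comm (Real.log n), hlog, div_le_div_iff₀
    (by positivity) hA]
  calc Real.log Q * Real.log (∏ e, F e : ℕ)
      ≤ g * (Real.log 2 + Real.log (L / C)) * Real.log (∏ e, F e : ℕ) := by gcongr
    _ = _ := by ring

/-- The asymptotic sum inequality as a statement about a single `τ ≥ 0`: the `N`-th power of the
direct sum gives an upper bound on the exponent per edge that differs from `τ` by `O(log N / N)`. -/
theorem exponentPerEdge_le (hG : IsEdgeTransitive G) {p : ℕ} (hp : 1 ≤ p)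
    {f : Fin p → G.edgeSet → ℕ} (hf : ∀ i, 2 ≤ ∏ e, f i e) {τ : ℝ} (hτ : 0 ≤ τ)
    (hR : (borderRank (directSum fun i => graphTensor G (f i)) : ℝ) ≤
      ∑ i, (∏ e, (f i e : ℝ)) ^ τ) : exponentPerEdge G ≤ (τ : EReal) := by
  classical
  set R := borderRank (directSum fun i => graphTensor G (f i))
  have hdeg := borderRank_degenerates (directSum fun i => graphTensor G (f i))
  set D := Fintype.card (∀ v, Σ i, LegIndex G (f i) v)
  have h2 : 0 < Real.log 2 := Real.log_pos (by norm_num)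
  have hbound : ∀ N : ℕ, 1 ≤ N → exponentPerEdge G ≤
      ((τ + (Real.log 2 + (D + p : ℕ) * Real.log (N + 1)) / (N * Real.log 2) : ℝ) : EReal) := by
    intro N hN
    obtain ⟨C, w, F, hw, hF, hC, hA, hsum⟩ := exists_words hp f hf τ N
    have hrank := (hdeg.rankLE_tensorPow N).copies_of_words w hw hF
    set L := (N + 1) ^ D * R ^ N with hL
    have hA1 : (1 : ℝ) ≤ (∏ e, F e : ℕ) := by exact_mod_cast Nat.one_le_two_pow.trans hA
    have hA2 : 2 ≤ ∏ e, F e := (Nat.le_self_pow (by omega) 2).trans hA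
    have hC0 : (0 : ℝ) < C := by exact_mod_cast hC
    -- replacing `L` by `max L C` makes the quotient by `C` at least `1`
    have hmain := exponentPerEdge_le_of_rankLE_copies hG (hrank.mono (le_max_left L C)) hC
      (le_max_right L C) hA2
    refine hmain.trans (EReal.coe_le_coe_iff.2 ?_)
    have hlogA : N * Real.log 2 ≤ Real.log (∏ e, F e : ℕ) := by
      rw [← Real.log_pow]
      exact Real.log_le_log (by positivity) (by exact_mod_cast hA)
    have hN0 : (0 : ℝ) < N := by exact_mod_cast hN
    have hlogA0 : 0 < Real.log (∏ e, F e : ℕ) := lt_of_lt_of_le (by positivity) hlogA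
    have hle : ((max L C : ℕ) : ℝ) / C ≤ (N + 1) ^ (D + p) * ((∏ e, F e : ℕ) : ℝ) ^ τ := by
      rw [div_le_iff₀ hC0, Nat.cast_max]
      have hone : (1 : ℝ) ≤ (∏ e, F e : ℕ) ^ τ := Real.one_le_rpow hA1 hτ
      have hN1 : (1 : ℝ) ≤ N + 1 := by linarith
      refine max_le ?_ ?_
      · calc (L : ℝ) = (N + 1) ^ D * R ^ N := by rw [hL]; push_cast; rfl
          _ ≤ (N + 1) ^ D * (∑ i, (∏ e, (f i e : ℝ)) ^ τ) ^ N := by gcongr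
          _ ≤ (N + 1) ^ D * ((N + 1) ^ p * (C * (∏ e, (F e : ℝ)) ^ τ)) := by gcongr
          _ = _ := by push_cast; ring
      · have := one_le_mul_of_one_le_of_one_le (one_le_pow₀ hN1 (n := D + p)) hone
        nlinarith
    have hlog : Real.log (((max L C : ℕ) : ℝ) / C) ≤
        (D + p : ℕ) * Real.log (N + 1) + τ * Real.log (∏ e, F e : ℕ) := by
      have hpos : 0 < ((max L C : ℕ) : ℝ) / C :=
        div_pos (by exact_mod_cast lt_of_lt_of_le hC (le_max_right L C)) hC0
      have hA0 : (0 : ℝ) < (∏ e, F e : ℕ) := zero_lt_one.trans_le hA1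
      refine (Real.log_le_log hpos hle).trans_eq ?_
      rw [Real.log_mul (by positivity) (Real.rpow_pos_of_pos hA0 τ).ne', Real.log_pow,
        Real.log_rpow hA0]
    have hnum : 0 ≤ Real.log 2 + (D + p : ℕ) * Real.log (N + 1) := by
      have : 0 ≤ Real.log ((N : ℝ) + 1) := Real.log_nonneg (by linarith)
      positivity
    calc (Real.log 2 + Real.log (((max L C : ℕ) : ℝ) / C)) / Real.log (∏ e, F e : ℕ)
        ≤ (Real.log 2 + ((D + p : ℕ) * Real.log (N + 1) + τ * Real.log (∏ e, F e : ℕ))) /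
            Real.log (∏ e, F e : ℕ) := by gcongr
      _ = τ + (Real.log 2 + (D + p : ℕ) * Real.log (N + 1)) / Real.log (∏ e, F e : ℕ) := by
          field_simp; ring
      _ ≤ _ := by gcongr
  have hlim : Filter.Tendsto (fun N : ℕ => τ +
      (Real.log 2 + (D + p : ℕ) * Real.log (N + 1)) / (N * Real.log 2)) Filter.atTop
      (nhds τ) := by
    have h0 : Filter.Tendsto (fun N : ℕ => Real.log ((N : ℝ) + 1) / N) Filter.atTop (nhds 0) := by
      have := (Real.tendsto_pow_log_div_mul_add_atTop 1 (-1) 1 one_ne_zero).comp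
        (Filter.tendsto_atTop_add_const_right _ (1 : ℝ) tendsto_natCast_atTop_atTop)
      simpa [Function.comp_def] using this
    have h1 := (tendsto_const_div_atTop_nhds_zero_nat (Real.log 2)).add
      (h0.const_mul ((D + p : ℕ) : ℝ))
    have h3 := (h1.div_const (Real.log 2)).const_add τ
    simp only [mul_zero, add_zero, zero_div] at h3
    refine h3.congr fun N => ?_
    rw [← mul_div_assoc, ← add_div, div_div]
  refine ge_of_tendsto ((continuous_coe_real_ereal.tendsto τ).comp hlim) ?_
  filter_upwards [Filter.eventually_ge_atTop 1] with N hN using hbound N hN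

end Exponent

/-! ### The equation defining the bound -/

theorem strictMono_sum_rpow {p : ℕ} (hp : 1 ≤ p) {a : Fin p → ℝ} (ha : ∀ i, 1 < a i) :
    StrictMono fun τ : ℝ => ∑ i, a i ^ τ := fun _ _ h =>
  Finset.sum_lt_sum_of_nonempty ⟨⟨0, hp⟩, Finset.mem_univ _⟩
    fun i _ => Real.rpow_lt_rpow_of_exponent_lt (ha i) h

theorem exists_sum_rpow_eq {p : ℕ} (hp : 1 ≤ p) {a : Fin p → ℝ} (ha : ∀ i, 1 < a i) {r : ℝ}
    (hr : (p : ℝ) ≤ r) : ∃ τ : ℝ, ∑ i, a i ^ τ = r := by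
  have ha0 : ∀ i, a i ≠ 0 := fun i => (zero_lt_one.trans (ha i)).ne'
  have hcont : Continuous fun τ : ℝ => ∑ i, a i ^ τ :=
    continuous_finsetSum _ fun i _ => Real.continuous_const_rpow (ha0 i)
  let i₀ : Fin p := ⟨0, hp⟩
  have hr0 : 0 < r := lt_of_lt_of_le (by exact_mod_cast hp) hr
  refine mem_range_of_exists_le_of_exists_ge hcont ⟨0, by simpa using hr⟩ ⟨Real.logb (a i₀) r, ?_⟩
  calc r = a i₀ ^ Real.logb (a i₀) r :=
        (Real.rpow_logb (zero_lt_one.trans (ha i₀)) (ha i₀).ne' hr0).symm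
    _ ≤ _ := Finset.single_le_sum (f := fun i => a i ^ Real.logb (a i₀) r)
        (fun i _ => Real.rpow_nonneg (zero_lt_one.trans (ha i)).le _) (Finset.mem_univ i₀)

end GraphTensor

theorem mainTheorem5 {V : Type*} [Fintype V] [DecidableEq V] (G : SimpleGraph V)
    [DecidableRel G.Adj] (hG : GraphTensor.IsEdgeTransitive G) {p : ℕ} (hp : 1 ≤ p)
    (f : Fin p → G.edgeSet → ℕ) :
    ((∀ i, 2 ≤ ∏ e, f i e) →
      ∀ r : ℝ, (p : ℝ) < r →
        (GraphTensor.borderRank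
          (GraphTensor.directSum fun i => GraphTensor.graphTensor G (f i)) : ℝ) ≤ r →
        (∃! τ : ℝ, ∑ i, (∏ e, (f i e : ℝ)) ^ τ = r) ∧
        ∀ τ : ℝ, ∑ i, (∏ e, (f i e : ℝ)) ^ τ = r →
          GraphTensor.exponentPerEdge G ≤ (τ : EReal)) ∧
    (∀ q : ℕ, 2 ≤ q → (∀ i, ∏ e, f i e = q) →
      GraphTensor.exponentPerEdge G ≤
        ((Real.logb q
          ((GraphTensor.borderRank
            (GraphTensor.directSum fun i => GraphTensor.graphTensor G (f i)) : ℝ) / p) : ℝ) :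
          EReal)) := by
  have edge : ∀ i, 2 ≤ ∏ e, f i e → ∃ e : Sym2 V, e ∈ G.edgeSet := fun i h => by
    by_contra! hne
    have : IsEmpty G.edgeSet := ⟨fun e => hne e.1 e.2⟩
    simp at h
  refine ⟨fun hf r hpr hr => ?_, fun q hq hf => ?_⟩
  · have ha : ∀ i, 1 < ∏ e, (f i e : ℝ) := fun i => by
      rw [← Nat.cast_prod]
      exact_mod_cast hf i
    have hmono := GraphTensor.strictMono_sum_rpow hp ha
    obtain ⟨τ, hτ⟩ := GraphTensor.exists_sum_rpow_eq hp ha hpr.le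
    refine ⟨⟨τ, hτ, fun τ' h => hmono.injective (h.trans hτ.symm)⟩, fun τ' h => ?_⟩
    obtain ⟨e, -⟩ := edge ⟨0, hp⟩ (hf _)
    have : Nonempty V := ⟨(Quot.out e).1⟩
    refine GraphTensor.exponentPerEdge_le hG hp hf (hmono.le_iff_le.1 ?_) (hr.trans_eq h.symm)
    simpa [h] using hpr.le
  · have hf2 : ∀ i, 2 ≤ ∏ e, f i e := fun i => (hf i).symm ▸ hq
    have hq1 : (1 : ℝ) < q := by exact_mod_cast hq
    have hp0 : (0 : ℝ) < p := by exact_mod_cast hp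
    obtain ⟨e, he⟩ := edge ⟨0, hp⟩ (hf2 _)
    induction e using Sym2.ind with | _ u v
    have : Nonempty V := ⟨u⟩
    -- needed for `log_q (R / p) ≥ 0`
    have hpR : (p : ℝ) ≤ (GraphTensor.borderRank
        (GraphTensor.directSum fun i => GraphTensor.graphTensor G (f i)) : ℝ) := by
      refine Nat.cast_le.2 (GraphTensor.le_borderRank_directSum (fun i e => ?_)
        (G.ne_of_adj (G.mem_edgeSet.1 he)))
      refine Nat.pos_of_ne_zero fun h0 => ?_
      have := hf2 i
      rw [Finset.prod_eq_zero (Finset.mem_univ e) h0] at this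
      omega
    refine GraphTensor.exponentPerEdge_le hG hp hf2
      (Real.logb_nonneg hq1 ((one_le_div hp0).2 hpR)) (le_of_eq ?_)
    have hterm : ∀ i, ∏ e, (f i e : ℝ) = q := fun i => by exact_mod_cast hf i
    simp only [hterm]
    rw [Real.rpow_logb (by positivity) hq1.ne' (div_pos (hp0.trans_le hpR) hp0)]
    simp [mul_div_cancel₀ _ hp0.ne']
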